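/- For $A\subseteq\mathbb R$ let $H(A)$ denote the set $\mathbb R$ with the topology in which a point $x\in A$ has the sets $(x-\varepsilon,x+\varepsilon)$, $\varepsilon>0$, as a base of open neighbourhoods, and a point $x\in\mathbb R\setminus A$ has the sets $[x,x+\varepsilon)$, $\varepsilon>0$, as a base of open neighbourhoods. Let $\mathcal C_0=\{[0,1]\}$, and for $n\ge 1$ let $\mathcal C_n$ be the family of all intervals $[a,\tfrac23a+\tfrac13b]$ and $[\tfrac13a+\tfrac23b,b]$ with $[a,b]\in\mathcal C_{n-1}$; let $\mathbb C=\bigcap_{n\ge0}\bigcup\mathcal C_n$ be the standard Cantor set. Put $B_2=\{b:[a,b]\in\mathcal C_n \text{ for some } n\ge0\}$ and $A_2=\mathbb R\setminus B_2$. Then: (a) $B_2$ is nowhere dense in $H(A_2)$ and, as a subspace of $H(A_2)$, is homeomorphic to the discrete space $\mathbb N$ of natural numbers. (b) The closure $\mathrm{Cl}_{H(A_2)}(B_2)$ of $B_2$ in $H(A_2)$ is equal, as a set, to the standard Cantor set $\mathbb C$, and as a subspace of $H(A_2)$ it is not $\sigma$-compact. The subspace $\mathrm{Cl}_{H(A_2)}(B_2)\setminus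 B_2$ of $H(A_2)$ is homeomorphic to the space of irrational numbers (with the topology inherited from the real line). (c) The space $H(A_2)$ is not $\sigma$-compact. -/

import Mathlib

/-- The Hattori space `H(A)` of a set `A ⊆ ℝ`: the real numbers with Hattori's topology `τ(A)`. -/
def HattoriSpace (_A : Set ℝ) : Type := ℝ

namespace HattoriSpace

/-- The identity of the underlying sets, from the reals to `H(A)`. -/
def of (A : Set ℝ) : ℝ ≃ HattoriSpace A := Equiv.refl ℝ

/-- The topology `τ(A)`: at the points of `A` the intervals `(x - ε, x + ε)` form a neighbourhood
base, at the other points the intervals `[x, x + ε)` do (see `nhds_basis_of_mem` and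
`nhds_basis_of_notMem`). -/
instance (A : Set ℝ) : TopologicalSpace (HattoriSpace A) where
  IsOpen U := ∀ x : ℝ, of A x ∈ U →
    (x ∈ A → ∃ ε > 0, of A '' Set.Ioo (x - ε) (x + ε) ⊆ U) ∧
    (x ∉ A → ∃ ε > 0, of A '' Set.Ico x (x + ε) ⊆ U)
  isOpen_univ _ _ := ⟨fun _ => ⟨1, one_pos, Set.subset_univ _⟩,
    fun _ => ⟨1, one_pos, Set.subset_univ _⟩⟩
  isOpen_inter U V hU hV x hx := by
    refine ⟨fun h => ?_, fun h => ?_⟩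
    · obtain ⟨e, he, h1⟩ := (hU x hx.1).1 h
      obtain ⟨d, hd, h2⟩ := (hV x hx.2).1 h
      refine ⟨min e d, lt_min he hd, Set.subset_inter ?_ ?_⟩
      · refine (Set.image_mono (Set.Ioo_subset_Ioo ?_ ?_)).trans h1 <;>
          linarith [min_le_left e d]
      · refine (Set.image_mono (Set.Ioo_subset_Ioo ?_ ?_)).trans h2 <;>
          linarith [min_le_right e d]
    · obtain ⟨e, he, h1⟩ := (hU x hx.1).2 h
      obtain ⟨d, hd, h2⟩ := (hV x hx.2).2 h
      refine ⟨min e d, lt_min he hd, Set.subset_inter ?_ ?_⟩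
      · refine (Set.image_mono (Set.Ico_subset_Ico_right ?_)).trans h1
        linarith [min_le_left e d]
      · refine (Set.image_mono (Set.Ico_subset_Ico_right ?_)).trans h2
        linarith [min_le_right e d]
  isOpen_sUnion S hS x := by
    rintro ⟨U, hU, hx⟩
    refine ⟨fun h => ?_, fun h => ?_⟩
    · obtain ⟨e, he, h1⟩ := (hS U hU x hx).1 h
      exact ⟨e, he, h1.trans (Set.subset_sUnion_of_mem hU)⟩
    · obtain ⟨e, he, h1⟩ := (hS U hU x hx).2 h
      exact ⟨e, he, h1.trans (Set.subset_sUnion_of_mem hU)⟩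

theorem isOpen_def {A : Set ℝ} {U : Set (HattoriSpace A)} :
    IsOpen U ↔ ∀ x : ℝ, of A x ∈ U →
      (x ∈ A → ∃ ε > 0, of A '' Set.Ioo (x - ε) (x + ε) ⊆ U) ∧
      (x ∉ A → ∃ ε > 0, of A '' Set.Ico x (x + ε) ⊆ U) := Iff.rfl

theorem isOpen_image_Ioo (A : Set ℝ) (a b : ℝ) : IsOpen (of A '' Set.Ioo a b) := by
  intro x hx
  obtain ⟨h1, h2⟩ : x ∈ Set.Ioo a b := by simpa using hx
  refine ⟨fun _ => ⟨min (x - a) (b - x), lt_min (by linarith) (by linarith), ?_⟩,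
    fun _ => ⟨b - x, by linarith, ?_⟩⟩
  · refine Set.image_mono (Set.Ioo_subset_Ioo ?_ ?_)
    · linarith [min_le_left (x - a) (b - x)]
    · linarith [min_le_right (x - a) (b - x)]
  · refine Set.image_mono fun y hy => ⟨by linarith [hy.1], by linarith [hy.2]⟩

theorem isOpen_image_Ico {A : Set ℝ} {a : ℝ} (ha : a ∉ A) (b : ℝ) :
    IsOpen (of A '' Set.Ico a b) := by
  intro x hx
  obtain ⟨h1, h2⟩ : x ∈ Set.Ico a b := by simpa using hx
  refine ⟨fun hxA => ⟨min (x - a) (b - x), lt_min ?_ (by linarith), ?_⟩,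
    fun _ => ⟨b - x, by linarith, ?_⟩⟩
  · rcases h1.lt_or_eq with h | h
    · linarith
    · exact absurd (h ▸ hxA) ha
  · refine Set.image_mono fun y hy => ⟨?_, ?_⟩
    · linarith [min_le_left (x - a) (b - x), hy.1]
    · linarith [min_le_right (x - a) (b - x), hy.2]
  · refine Set.image_mono fun y hy => ⟨by linarith [hy.1], by linarith [hy.2]⟩

theorem nhds_basis_of_mem {A : Set ℝ} {x : ℝ} (hx : x ∈ A) :
    (nhds (of A x)).HasBasis (fun ε : ℝ => 0 < ε)
      fun ε => of A '' Set.Ioo (x - ε) (x + ε) := by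
  refine ⟨fun t => ⟨fun ht => ?_, ?_⟩⟩
  · obtain ⟨U, hUt, hU, hxU⟩ := mem_nhds_iff.1 ht
    obtain ⟨e, he, h⟩ := (isOpen_def.1 hU x hxU).1 hx
    exact ⟨e, he, h.trans hUt⟩
  · rintro ⟨e, he, h⟩
    exact mem_nhds_iff.2 ⟨_, h, isOpen_image_Ioo A _ _,
      Set.mem_image_of_mem _ ⟨by linarith, by linarith⟩⟩

theorem nhds_basis_of_notMem {A : Set ℝ} {x : ℝ} (hx : x ∉ A) :
    (nhds (of A x)).HasBasis (fun ε : ℝ => 0 < ε)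
      fun ε => of A '' Set.Ico x (x + ε) := by
  refine ⟨fun t => ⟨fun ht => ?_, ?_⟩⟩
  · obtain ⟨U, hUt, hU, hxU⟩ := mem_nhds_iff.1 ht
    obtain ⟨e, he, h⟩ := (isOpen_def.1 hU x hxU).2 hx
    exact ⟨e, he, h.trans hUt⟩
  · rintro ⟨e, he, h⟩
    exact mem_nhds_iff.2 ⟨_, h, isOpen_image_Ico hx _,
      Set.mem_image_of_mem _ ⟨le_rfl, by linarith⟩⟩

end HattoriSpace

/-- The family `𝒞ₙ` of the `2 ^ n` closed intervals of the `n`-th stage of the construction of the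
Cantor set, an interval `[a, b]` being recorded as the pair `(a, b)` of its endpoints. -/
def cantorIntervals : ℕ → Set (ℝ × ℝ)
  | 0 => {(0, 1)}
  | n + 1 => ⋃ I ∈ cantorIntervals n,
      {(I.1, 2 / 3 * I.1 + 1 / 3 * I.2), (1 / 3 * I.1 + 2 / 3 * I.2, I.2)}

/-- `B₂`: the right endpoints of the intervals of all the families `𝒞ₙ`, `n ≥ 0`. -/
def cantorRightEndpoints : Set ℝ :=
  {b | ∃ n a, (a, b) ∈ cantorIntervals n}

/-- The Hattori space `H(A₂)`, where `A₂ = ℝ \ B₂`. -/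
abbrev HattoriA₂ : Type := HattoriSpace cantorRightEndpointsᶜ

/-- `B₂` as a subset of `H(A₂)`. -/
def hattoriB₂ : Set HattoriA₂ :=
  HattoriSpace.of cantorRightEndpointsᶜ '' cantorRightEndpoints

/-!
The set `B₂` is discrete in `H(A₂)` because every right endpoint is followed by a gap of the Cantor
set (`exists_Ioo_disjoint_cantorSet`), and its closure is the Cantor set because every point of the
Cantor set has right endpoints arbitrarily close to it, at or after it (`exists_rightEndpoint_mem_Ico`). As
neighbourhoods in `H(A₂)` contain half-open intervals, which the Cantor set never contains
(`not_Ico_subset_cantorSet`), `B₂` is nowhere dense.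

At points outside `B₂` the topology is that of the line, so `closure B₂ \ B₂` is `cantorSet \ B₂`
with its Euclidean topology (`HattoriSpace.homeomorphImage`). Both this space and the space of
irrationals are homeomorphic to the Baire space `ℕ → ℕ`: they are Gδ subsets of `ℝ` with dense
complement in which every point is a limit of points of the closure lying outside the set. Hence
they are zero-dimensional Polish spaces without nonempty compact open sets, and the
Alexandrov–Urysohn characterization `nonempty_homeomorph_nat_arrow_nat` applies. That
characterization is proved by splitting clopen sets again and again into infinitely many smaller
ones (`IsClopen.exists_nat_partition`), which gives a scheme indexed by finite sequences of natural
numbers whose branches are the points of the space.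

Finally, the irrationals are not σ-compact by Baire's theorem (`not_sigmaCompactSpace_irrational`).
Since the points of `B₂` are isolated in `closure B₂`, the set `closure B₂ \ B₂` is closed in
`H(A₂)`; so neither `closure B₂` nor `H(A₂)` is σ-compact.
-/

/-! ### Zero-dimensional Polish spaces homeomorphic to the Baire space -/

open TopologicalSpace Set in
/-- A clopen set that is not compact splits into infinitely many nonempty clopen pieces of small
diameter: refine a cover without a finite subcover by small clopen sets, make the refinement
disjoint, and discard the empty sets. Infinitely many survive, since otherwise the original cover
would have a finite subcover. -/
theorem IsClopen.exists_nat_partition {X : Type*} [MetricSpace X] [SecondCountableTopology X]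
    (hb : IsTopologicalBasis {s : Set X | IsClopen s}) {U : Set X} (hU : IsClopen U)
    (hc : ¬ IsCompact U) {ε : ENNReal} (hε : 0 < ε) :
    ∃ f : ℕ → Set X, (∀ k, IsClopen (f k) ∧ (f k).Nonempty ∧ Metric.ediam (f k) ≤ ε) ∧
      Pairwise (Function.onFun Disjoint f) ∧ ⋃ k, f k = U := by
  obtain ⟨ι, V, hVo, hUV, hV⟩ : ∃ (ι : Type _) (V : ι → Set X), (∀ i, IsOpen (V i)) ∧
      U ⊆ ⋃ i, V i ∧ ∀ t : Finset ι, ¬ U ⊆ ⋃ i ∈ t, V i := by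
    by_contra! h
    exact hc (isCompact_of_finite_subcover fun V h1 h2 => h _ V h1 h2)
  have hW : ∀ x : X, ∃ W : Set X, IsClopen W ∧ x ∈ W ∧ Metric.ediam W ≤ ε ∧
      (x ∉ U → W ⊆ Uᶜ) ∧ (x ∈ U → ∃ i, W ⊆ V i) := by
    intro x
    have hball : Metric.eball x (ε / 2) ∈ nhds x :=
      Metric.eball_mem_nhds x (ENNReal.half_pos hε.ne')
    have hdiam : Metric.ediam (Metric.eball x (ε / 2)) ≤ ε := by
      refine Metric.ediam_eball_le.trans_eq ?_
      rw [ENNReal.mul_div_cancel (by simp) (by simp)]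
    by_cases hx : x ∈ U
    · obtain ⟨i, hi⟩ := mem_iUnion.1 (hUV hx)
      obtain ⟨W, hW, hxW, hWs⟩ := hb.mem_nhds_iff.1
        (Filter.inter_mem hball ((hVo i).mem_nhds hi))
      exact ⟨W, hW, hxW, (Metric.ediam_mono (hWs.trans inter_subset_left)).trans hdiam,
        fun h => absurd hx h, fun _ => ⟨i, hWs.trans inter_subset_right⟩⟩
    · obtain ⟨W, hW, hxW, hWs⟩ := hb.mem_nhds_iff.1
        (Filter.inter_mem hball (hU.compl.isOpen.mem_nhds hx))
      exact ⟨W, hW, hxW, (Metric.ediam_mono (hWs.trans inter_subset_left)).trans hdiam,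
        fun _ => hWs.trans inter_subset_right, fun h => absurd h hx⟩
  choose W hWc hxW hWd hWU hWV using hW
  obtain ⟨t, htc, ht⟩ := TopologicalSpace.countable_cover_nhds fun x => (hWc x).isOpen.mem_nhds (hxW x)
  have hne : U.Nonempty := by
    rw [nonempty_iff_ne_empty]
    rintro rfl
    exact hc isCompact_empty
  have htne : t.Nonempty := by
    obtain ⟨x, -⟩ := hne
    obtain ⟨y, hy, -⟩ := mem_iUnion₂.1 (ht.symm ▸ mem_univ x : x ∈ ⋃ y ∈ t, W y)
    exact ⟨y, hy⟩
  obtain ⟨g, rfl⟩ := htc.exists_eq_range htne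
  set G : ℕ → Set X := fun n => W (g n) ∩ U with hG
  have hGU : ⋃ n, G n = U := by
    rw [hG, ← iUnion_inter, ← biUnion_range (f := g) (g := W), ht, univ_inter]
  have hclopen : ∀ n, IsClopen (disjointed G n) := fun n =>
    disjointedRec (fun _ _ h => h.diff ((hWc _).inter hU)) ((hWc _).inter hU)
  set N : Set ℕ := {n | (disjointed G n).Nonempty} with hN
  have hUN : ∀ x ∈ U, ∃ n ∈ N, x ∈ disjointed G n := by
    intro x hx
    rw [← hGU, ← iUnion_disjointed] at hx
    obtain ⟨n, hn⟩ := mem_iUnion.1 hx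
    exact ⟨n, ⟨x, hn⟩, hn⟩
  have hinf : N.Infinite := by
    intro hfin
    have hsel : ∀ n : N, ∃ i, G n ⊆ V i := by
      rintro ⟨n, y, hy⟩
      have hy := disjointed_subset G n hy
      obtain ⟨i, hi⟩ := hWV (g n) (by_contra fun h => hWU _ h hy.1 hy.2)
      exact ⟨i, inter_subset_left.trans hi⟩
    choose i hi using hsel
    classical
    have := hfin.fintype
    refine hV (Finset.univ.image i) fun x hx => ?_
    obtain ⟨n, hn, hxn⟩ := hUN x hx
    refine mem_iUnion₂.2 ⟨i ⟨n, hn⟩, Finset.mem_image_of_mem _ (Finset.mem_univ _), ?_⟩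
    exact hi ⟨n, hn⟩ (disjointed_subset G n hxn)
  have : Infinite N := hinf.to_subtype
  obtain ⟨e⟩ := nonempty_equiv_of_countable (α := ℕ) (β := N)
  refine ⟨fun k => disjointed G (e k), fun k => ⟨hclopen _, (e k).2, ?_⟩, ?_, ?_⟩
  · exact (Metric.ediam_mono ((disjointed_subset G _).trans inter_subset_left)).trans (hWd _)
  · intro k l hkl
    exact disjoint_disjointed G fun h => hkl (e.injective (Subtype.ext h))
  · refine Subset.antisymm (iUnion_subset fun k => (disjointed_subset G _).trans inter_subset_right)
      fun x hx => ?_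
    obtain ⟨n, hn, hxn⟩ := hUN x hx
    exact mem_iUnion.2 ⟨e.symm ⟨n, hn⟩, by simpa using hxn⟩

open TopologicalSpace Set CantorScheme in
/-- The Alexandrov–Urysohn characterization of the Baire space `ℕ → ℕ`: it is the only nonempty
zero-dimensional Polish space in which no nonempty clopen set is compact. -/
theorem nonempty_homeomorph_nat_arrow_nat {X : Type*} [TopologicalSpace X] [PolishSpace X]
    [Nonempty X] (hb : IsTopologicalBasis {s : Set X | IsClopen s})
    (hc : ∀ U : Set X, IsClopen U → U.Nonempty → ¬ IsCompact U) :
    Nonempty ((ℕ → ℕ) ≃ₜ X) := by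
  let := upgradeIsCompletelyMetrizable X
  -- The bound on the diameter at depth `0` is `0⁻¹ = ∞` in `ENNReal`, so it holds vacuously there.
  have hsplit : ∀ (U : Set X) (n : ℕ), ∃ f : ℕ → Set X, IsClopen U ∧ U.Nonempty →
      (∀ k, IsClopen (f k) ∧ (f k).Nonempty ∧ Metric.ediam (f k) ≤ (n : ENNReal)⁻¹) ∧
      Pairwise (Function.onFun Disjoint f) ∧ ⋃ k, f k = U := by
    intro U n
    by_cases h : IsClopen U ∧ U.Nonempty
    · obtain ⟨f, hf⟩ := h.1.exists_nat_partition hb (hc U h.1 h.2)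
        (ε := (n : ENNReal)⁻¹) (by simp)
      exact ⟨f, fun _ => hf⟩
    · exact ⟨fun _ => ∅, fun h' => absurd h' h⟩
  choose F hF using hsplit
  let D : List ℕ → Set X := fun l => List.rec univ (fun a l s => F s l.length a) l
  have hD : ∀ a l, D (a :: l) = F (D l) l.length a := fun _ _ => rfl
  have hDc : ∀ l, IsClopen (D l) ∧ (D l).Nonempty := by
    intro l
    induction l with
    | nil => exact ⟨isClopen_univ, univ_nonempty⟩
    | cons a l ih =>
      have := (hF _ l.length ih).1 a
      exact ⟨this.1, this.2.1⟩
  have hunion : ∀ l, ⋃ a, D (a :: l) = D l := fun l => (hF _ l.length (hDc l)).2.2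
  have hanti : CantorScheme.Antitone D := fun l a => (hunion l) ▸ subset_iUnion _ a
  have hdisj : CantorScheme.Disjoint D := fun l => (hF _ l.length (hDc l)).2.1
  have hvan : VanishingDiam D := by
    intro x
    refine (Filter.tendsto_add_atTop_iff_nat 1).1 ?_
    refine tendsto_of_tendsto_of_tendsto_of_le_of_le tendsto_const_nhds
      ENNReal.tendsto_inv_nat_nhds_zero (fun _ => zero_le) fun n => ?_
    have h := ((hF _ (PiNat.res x n).length (hDc (PiNat.res x n))).1 (x n)).2.2
    rw [PiNat.res_length] at h
    simpa [PiNat.res_succ, hD] using h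
  have hdom : (inducedMap D).1 = univ :=
    (hanti.closureAntitone fun l => (hDc l).1.isClosed).map_of_vanishingDiam hvan
      fun l => (hDc l).2
  let φ : (ℕ → ℕ) → X := fun x => (inducedMap D).2 ⟨x, hdom ▸ mem_univ x⟩
  have hφmem : ∀ x n, φ x ∈ D (PiNat.res x n) := fun x n => map_mem _ n
  have hφc : Continuous φ := hvan.map_continuous.comp (continuous_id.subtype_mk _)
  have hφi : Function.Injective φ := fun x y h => congrArg Subtype.val (hdisj.map_injective h)
  -- Every point of a member of the scheme lies on a branch that starts with that member.
  have himage : ∀ x n y, y ∈ D (PiNat.res x n) →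
      ∃ z ∈ PiNat.cylinder x n, φ z = y := by
    intro x n y hy
    have hstep : ∀ l : List ℕ, ∃ a, y ∈ D l → y ∈ D (a :: l) := by
      intro l
      rcases Classical.em (y ∈ D l) with h | h
      · obtain ⟨a, ha⟩ := mem_iUnion.1 ((hunion l).ge h)
        exact ⟨a, fun _ => ha⟩
      · exact ⟨0, fun h' => absurd h' h⟩
    choose s hs using hstep
    -- `L k` extends `res x n` by `k` entries that keep `y` in the scheme, and `z` is its limit.
    let L : ℕ → List ℕ := fun k => Nat.rec (PiNat.res x n) (fun _ l => s l :: l) k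
    let z : ℕ → ℕ := fun k => if k < n then x k else s (L (k - n))
    have hzx : ∀ i < n, z i = x i := fun i hi => by simp [z, hi]
    have hzL : ∀ k, PiNat.res z (n + k) = L k := by
      intro k
      induction k with
      | zero => exact PiNat.res_eq_res.2 fun i hi => hzx i hi
      | succ k ih =>
        have : z (n + k) = s (L k) := by simp [z]
        rw [← add_assoc, PiNat.res_succ, ih, this]
    have hyL : ∀ k, y ∈ D (L k) := by
      intro k
      induction k with
      | zero => exact hy
      | succ k ih => exact hs _ ih
    refine ⟨z, PiNat.mem_cylinder_iff.2 hzx, ?_⟩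
    refine eq_of_forall_dist_le fun ε hε => ?_
    obtain ⟨m, hm⟩ := hvan.dist_lt ε hε z
    have hmono : D (PiNat.res z (n + m)) ⊆ D (PiNat.res z m) :=
      antitone_nat_of_succ_le (f := fun k => D (PiNat.res z k)) (fun k => hanti _ _)
        (Nat.le_add_left m n)
    exact (hm _ (hφmem z m) _ (hmono (hzL m ▸ hyL m))).le
  have hφs : Function.Surjective φ := fun y =>
    let ⟨z, _, hz⟩ := himage 0 0 y (mem_univ y)
    ⟨z, hz⟩
  have hφo : IsOpenMap φ := by
    refine (PiNat.isTopologicalBasis_cylinders fun _ => ℕ).isOpenMap_iff.2 ?_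
    rintro _ ⟨x, n, rfl⟩
    have : φ '' PiNat.cylinder x n = D (PiNat.res x n) := by
      refine Subset.antisymm ?_ fun y hy => himage x n y hy
      rintro _ ⟨z, hz, rfl⟩
      rw [PiNat.cylinder_eq_res] at hz
      exact (show PiNat.res z n = PiNat.res x n from hz) ▸ hφmem z n
    rw [this]
    exact (hDc _).1.isOpen
  exact ⟨(Equiv.ofBijective φ ⟨hφi, hφs⟩).toHomeomorphOfContinuousOpen hφc hφo⟩

open TopologicalSpace Set in
/-- Intervals with endpoints outside `S` trace clopen sets on `S`, so a subset of the line with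
dense complement is zero-dimensional. -/
theorem isTopologicalBasis_isClopen_of_dense_compl {S : Set ℝ} (hS : Dense Sᶜ) :
    IsTopologicalBasis {s : Set S | IsClopen s} := by
  refine isTopologicalBasis_of_isOpen_of_nhds (fun u hu => hu.isOpen) fun x u hx hu => ?_
  obtain ⟨v, hv, rfl⟩ := isOpen_induced_iff.1 hu
  obtain ⟨ε, hε, hball⟩ := Metric.isOpen_iff.1 hv x hx
  rw [Real.ball_eq_Ioo] at hball
  obtain ⟨a, ha, ha'⟩ := hS.exists_between (sub_lt_self (x : ℝ) hε)
  obtain ⟨b, hb, hb'⟩ := hS.exists_between (lt_add_of_pos_right (x : ℝ) hε)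
  refine ⟨(↑) ⁻¹' Ioo a b, ⟨?_, isOpen_Ioo.preimage continuous_subtype_val⟩,
    ⟨ha'.2, hb'.1⟩, fun y hy => hball ⟨ha'.1.trans hy.1, hy.2.trans hb'.2⟩⟩
  have : ((↑) ⁻¹' Ioo a b : Set S) = (↑) ⁻¹' Icc a b := by
    ext y
    have h1 : (y : ℝ) ≠ a := fun h => ha (h ▸ y.2)
    have h2 : (y : ℝ) ≠ b := fun h => hb (h ▸ y.2)
    simp only [mem_preimage, mem_Ioo, mem_Icc]
    exact ⟨fun h => ⟨h.1.le, h.2.le⟩, fun h => ⟨h.1.lt_of_ne h1.symm, h.2.lt_of_ne h2⟩⟩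
  rw [this]
  exact isClosed_Icc.preimage continuous_subtype_val

open Set in
/-- If every point of `S` is a limit of points of `closure S \ S`, then no nonempty relatively open
subset of `S` is compact. -/
theorem not_isCompact_of_subset_closure_diff {X : Type*} [TopologicalSpace X] [T2Space X]
    {S : Set X} (hS : S ⊆ closure (closure S \ S)) {U : Set S} (hU : IsOpen U)
    (hne : U.Nonempty) : ¬ IsCompact U := by
  intro hc
  obtain ⟨v, hv, rfl⟩ := isOpen_induced_iff.1 hU
  obtain ⟨x, hx⟩ := hne
  obtain ⟨y, hyv, hy, hyS⟩ := mem_closure_iff.1 (hS x.2) v hv hx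
  have hcl : IsClosed (Subtype.val '' (Subtype.val ⁻¹' v : Set S)) :=
    (hc.image continuous_subtype_val).isClosed
  rw [Subtype.image_preimage_coe] at hcl
  refine hyS (hcl.closure_subset_iff.2 Subset.rfl (mem_closure_iff.2 fun o ho hyo => ?_)).1
  obtain ⟨z, hz, hzS⟩ := mem_closure_iff.1 hy (o ∩ v) (ho.inter hv) ⟨hyo, hyv⟩
  exact ⟨z, hz.1, hzS, hz.2⟩

open Set in
/-- A Gδ subset `⋂ n, U n` of a Polish space is Polish: it is the diagonal, a closed subset, of the
product of the open sets `U n`. -/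
theorem IsGδ.polishSpace {X : Type*} [TopologicalSpace X] [PolishSpace X] {S : Set X}
    (hS : IsGδ S) : PolishSpace S := by
  obtain ⟨U, hU, rfl⟩ := hS.eq_iInter_nat
  have : ∀ n, PolishSpace (U n) := fun n => (hU n).polishSpace
  let δ : ↥(⋂ n, U n) → ∀ n, U n := fun x n => ⟨x, mem_iInter.1 x.2 n⟩
  have hδ : Continuous δ := continuous_pi fun n => continuous_subtype_val.subtype_mk _
  have hind : Topology.IsInducing δ :=
    Topology.IsInducing.of_comp hδ (g := fun f : ∀ n, U n => (f 0 : X)) (by fun_prop)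
      Topology.IsInducing.subtypeVal
  have hrange : range δ = ⋂ n, {f : ∀ n, U n | (f n : X) = f 0} := by
    ext f
    simp only [mem_range, mem_iInter, mem_ofPred_eq]
    refine ⟨?_, fun h => ⟨⟨f 0, mem_iInter.2 fun n => h n ▸ (f n).2⟩, ?_⟩⟩
    · rintro ⟨x, rfl⟩ n
      rfl
    · funext n
      exact Subtype.ext (h n).symm
  refine Topology.IsClosedEmbedding.polishSpace (f := δ) ⟨⟨hind, fun x y h => ?_⟩, ?_⟩
  · have h0 : δ x 0 = δ y 0 := congrFun h 0
    exact Subtype.ext (congrArg (fun u : U 0 => (u : X)) h0)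
  · rw [hrange]
    exact isClosed_iInter fun n => isClosed_eq (by fun_prop) (by fun_prop)

open Set in
theorem nonempty_homeomorph_nat_arrow_nat_of_isGδ {S : Set ℝ} (hG : IsGδ S) (hne : S.Nonempty)
    (hd : Dense Sᶜ) (hS : S ⊆ closure (closure S \ S)) : Nonempty ((ℕ → ℕ) ≃ₜ S) := by
  have : Nonempty S := hne.to_subtype
  have : PolishSpace S := hG.polishSpace
  exact nonempty_homeomorph_nat_arrow_nat (isTopologicalBasis_isClopen_of_dense_compl hd)
    fun U hU hne => not_isCompact_of_subset_closure_diff hS hU.isOpen hne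

/-! ### The irrational numbers -/

open Set in
theorem nonempty_homeomorph_nat_arrow_nat_irrational :
    Nonempty ((ℕ → ℕ) ≃ₜ {x : ℝ // Irrational x}) := by
  have hd : Dense {x : ℝ | Irrational x}ᶜ := by
    refine Rat.isDenseEmbedding_coe_real.dense.mono ?_
    rintro _ ⟨q, rfl⟩
    simp
  refine nonempty_homeomorph_nat_arrow_nat_of_isGδ (S := {x : ℝ | Irrational x})
    IsGδ.setOfPred_irrational ⟨_, irrational_sqrt_two⟩ hd ?_
  rw [show closure {x : ℝ | Irrational x} = univ from dense_irrational.closure_eq,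
    ← compl_eq_univ_sdiff, hd.closure_eq]
  exact subset_univ _

open Set in
/-- By Baire's theorem: a compact set of irrationals has empty interior in `ℝ`, so countably many
of them together with the countably many rational points cannot cover `ℝ`. -/
theorem not_sigmaCompactSpace_irrational : ¬ SigmaCompactSpace {x : ℝ // Irrational x} := by
  intro h
  let K : ℕ ⊕ ℚ → Set ℝ := Sum.elim
    (fun n => Subtype.val '' compactCovering {x : ℝ // Irrational x} n) fun q => {(q : ℝ)}
  have hK : ∀ i, IsClosed (K i) := by
    rintro (n | q)
    · exact ((isCompact_compactCovering _ n).image continuous_subtype_val).isClosed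
    · exact isClosed_singleton
  have hU : ⋃ i, K i = univ := by
    refine eq_univ_of_forall fun x => mem_iUnion.2 ?_
    by_cases hx : Irrational x
    · obtain ⟨n, hn⟩ := exists_mem_compactCovering (⟨x, hx⟩ : {x : ℝ // Irrational x})
      exact ⟨Sum.inl n, _, hn, rfl⟩
    · obtain ⟨q, hq⟩ := not_not.1 hx
      exact ⟨Sum.inr q, hq.symm⟩
  obtain ⟨n | q, hi⟩ := nonempty_interior_of_iUnion_of_closed hK hU
  · obtain ⟨_, hx, q, rfl⟩ := Rat.isDenseEmbedding_coe_real.dense.inter_open_nonempty _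
      isOpen_interior hi
    obtain ⟨y, -, hy⟩ := interior_subset hx
    exact y.2 ⟨q, hy.symm⟩
  · simp [K] at hi

/-! ### Intervals of the Cantor construction -/

open Set

/-- The recursion of `cantorIntervals` subdivides every interval of the last stage, that of
`preCantorSet` puts two scaled copies of the last stage side by side. The two agree. -/
theorem cantorIntervals_succ_eq_image (n : ℕ) :
    cantorIntervals (n + 1) = (fun I : ℝ × ℝ => (I.1 / 3, I.2 / 3)) '' cantorIntervals n ∪
      (fun I : ℝ × ℝ => ((2 + I.1) / 3, (2 + I.2) / 3)) '' cantorIntervals n := by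
  induction n with
  | zero =>
    ext ⟨a, b⟩
    simp only [cantorIntervals, mem_singleton_iff, iUnion_iUnion_eq_left, image_singleton,
      mem_insert_iff, mem_union, Prod.mk.injEq]
    norm_num
  | succ n ih =>
    have hdef : ∀ m, cantorIntervals (m + 1) = ⋃ I ∈ cantorIntervals m,
      {(I.1, 2 / 3 * I.1 + 1 / 3 * I.2), (1 / 3 * I.1 + 2 / 3 * I.2, I.2)} := fun _ => rfl
    conv_lhs => rw [hdef (n + 1), ih]
    conv_rhs => rw [hdef n]
    simp only [biUnion_union, biUnion_image, image_iUnion₂, image_pair]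
    congr 1 <;>
    · refine iUnion₂_congr fun I _ => ?_
      congr 2 <;> ring_nf

theorem preCantorSet_eq_biUnion_Icc (n : ℕ) :
    preCantorSet n = ⋃ I ∈ cantorIntervals n, Icc I.1 I.2 := by
  induction n with
  | zero => simp [cantorIntervals]
  | succ n ih =>
    rw [cantorIntervals_succ_eq_image, preCantorSet_succ, ih, biUnion_union, biUnion_image,
      biUnion_image, image_iUnion₂, image_iUnion₂]
    congr 1
    · refine iUnion₂_congr fun I _ => ?_
      ext y
      simp only [mem_image, mem_Icc]
      exact ⟨by rintro ⟨z, hz, rfl⟩; constructor <;> linarith [hz.1, hz.2],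
        fun h => ⟨3 * y, by constructor <;> linarith [h.1, h.2], by ring⟩⟩
    · refine iUnion₂_congr fun I _ => ?_
      ext y
      simp only [mem_image, mem_Icc]
      exact ⟨by rintro ⟨z, hz, rfl⟩; constructor <;> linarith [hz.1, hz.2],
        fun h => ⟨3 * y - 2, by constructor <;> linarith [h.1, h.2], by ring⟩⟩

theorem cantorIntervals_length {n : ℕ} {a b : ℝ} (h : (a, b) ∈ cantorIntervals n) :
    b - a = (1 / 3) ^ n := by
  induction n generalizing a b with
  | zero =>
    obtain ⟨rfl, rfl⟩ := Prod.mk.inj (show (a, b) = (0, 1) from h)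
    norm_num
  | succ n ih =>
    obtain ⟨⟨c, d⟩, hI, h | h⟩ := mem_iUnion₂.1 h <;>
    · obtain ⟨rfl, rfl⟩ := Prod.mk.inj (show (a, b) = (_, _) from h)
      rw [pow_succ, ← ih hI]
      ring

theorem cantorIntervals_lt {n : ℕ} {a b : ℝ} (h : (a, b) ∈ cantorIntervals n) : a < b := by
  have : (0 : ℝ) < (1 / 3) ^ n := by positivity
  linarith [cantorIntervals_length h]

theorem exists_cantorIntervals_left {n m : ℕ} (hnm : n ≤ m) {a b : ℝ}
    (h : (a, b) ∈ cantorIntervals n) : ∃ c, (a, c) ∈ cantorIntervals m := by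
  induction m, hnm using Nat.le_induction with
  | base => exact ⟨b, h⟩
  | succ m _ ih =>
    obtain ⟨c, hc⟩ := ih
    exact ⟨_, mem_iUnion₂.2 ⟨_, hc, Or.inl rfl⟩⟩

theorem exists_cantorIntervals_right {n m : ℕ} (hnm : n ≤ m) {a b : ℝ}
    (h : (a, b) ∈ cantorIntervals n) : ∃ c, (c, b) ∈ cantorIntervals m := by
  induction m, hnm using Nat.le_induction with
  | base => exact ⟨a, h⟩
  | succ m _ ih =>
    obtain ⟨c, hc⟩ := ih
    exact ⟨_, mem_iUnion₂.2 ⟨_, hc, Or.inr rfl⟩⟩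

theorem Icc_subset_preCantorSet {n : ℕ} {a b : ℝ} (h : (a, b) ∈ cantorIntervals n) :
    Icc a b ⊆ preCantorSet n := by
  rw [preCantorSet_eq_biUnion_Icc]
  exact subset_biUnion_of_mem (u := fun I : ℝ × ℝ => Icc I.1 I.2) h

theorem mem_cantorSet_of_forall_ge {x : ℝ} {n : ℕ} (h : ∀ m ≥ n, x ∈ preCantorSet m) :
    x ∈ cantorSet :=
  mem_iInter.2 fun m => preCantorSet_antitone (le_max_right n m) (h _ (le_max_left n m))

theorem left_mem_cantorSet {n : ℕ} {a b : ℝ} (h : (a, b) ∈ cantorIntervals n) :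
    a ∈ cantorSet :=
  mem_cantorSet_of_forall_ge fun _ hm =>
    let ⟨_, hc⟩ := exists_cantorIntervals_left hm h
    Icc_subset_preCantorSet hc (left_mem_Icc.2 (cantorIntervals_lt hc).le)

theorem cantorRightEndpoints_subset_cantorSet : cantorRightEndpoints ⊆ cantorSet := by
  rintro b ⟨n, a, h⟩
  exact mem_cantorSet_of_forall_ge fun _ hm =>
    let ⟨_, hc⟩ := exists_cantorIntervals_right hm h
    Icc_subset_preCantorSet hc (right_mem_Icc.2 (cantorIntervals_lt hc).le)

theorem exists_pow_third_lt (k : ℕ) {ε : ℝ} (hε : 0 < ε) :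
    ∃ n ≥ k, (1 / 3 : ℝ) ^ n < ε := by
  obtain ⟨n, hn⟩ := exists_pow_lt_of_lt_one hε (by norm_num : (1 / 3 : ℝ) < 1)
  exact ⟨max k n, le_max_left _ _,
    (pow_le_pow_of_le_one (by norm_num) (by norm_num) (le_max_right _ _)).trans_lt hn⟩

/-- The right endpoint of a short interval of the construction containing `x` is close to `x`. -/
theorem exists_rightEndpoint_mem_Ico {x : ℝ} (hx : x ∈ cantorSet) {ε : ℝ} (hε : 0 < ε) :
    ∃ b ∈ cantorRightEndpoints, b ∈ Ico x (x + ε) := by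
  obtain ⟨n, -, hn⟩ := exists_pow_third_lt 0 hε
  have hxn := mem_iInter.1 hx n
  rw [preCantorSet_eq_biUnion_Icc] at hxn
  obtain ⟨⟨a, b⟩, hI, hxa, hxb⟩ := mem_iUnion₂.1 hxn
  simp only at hxa hxb
  exact ⟨b, ⟨n, a, hI⟩, hxb, by linarith [cantorIntervals_length hI]⟩

/-- A right endpoint is followed by a gap of the Cantor set. -/
theorem exists_Ioo_disjoint_cantorSet {b : ℝ} (hb : b ∈ cantorRightEndpoints) :
    ∃ ε > 0, ∀ y ∈ cantorSet, y ∉ Ioo b (b + ε) := by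
  obtain ⟨n, a, h⟩ := hb
  suffices ∃ ε > 0, ∀ y ∈ preCantorSet n, y ∉ Ioo b (b + ε) by
    obtain ⟨ε, hε, H⟩ := this
    exact ⟨ε, hε, fun y hy => H y (mem_iInter.1 hy n)⟩
  induction n generalizing a b with
  | zero =>
    obtain ⟨rfl, rfl⟩ := Prod.mk.inj (show (a, b) = (0, 1) from h)
    exact ⟨1, one_pos, fun y hy hy' => absurd hy'.1 (not_lt.2 hy.2)⟩
  | succ n ih =>
    rw [cantorIntervals_succ_eq_image] at h
    rw [preCantorSet_succ]
    obtain ⟨⟨c, d⟩, hI, h⟩ | ⟨⟨c, d⟩, hI, h⟩ := h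
    all_goals
      obtain ⟨rfl, rfl⟩ := Prod.mk.inj (show (_, _) = (a, b) from h)
      obtain ⟨ε, hε, H⟩ := ih _ hI
      have hd : d ∈ Icc (0 : ℝ) 1 := preCantorSet_subset_unitInterval
        (Icc_subset_preCantorSet hI (right_mem_Icc.2 (cantorIntervals_lt hI).le))
    · -- The bound `1 / 3` keeps the gap away from the right-hand copy, which starts at `2 / 3`.
      refine ⟨min (ε / 3) (1 / 3), by positivity, ?_⟩
      rintro _ (⟨z, hz, rfl⟩ | ⟨z, hz, rfl⟩) ⟨h1, h2⟩
      · simp only at h1 h2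
        exact H z hz ⟨by linarith, by linarith [min_le_left (ε / 3) (1 / 3)]⟩
      · have := (preCantorSet_subset_unitInterval hz).1
        simp only at h1 h2
        linarith [min_le_right (ε / 3) (1 / 3), hd.2]
    · refine ⟨ε / 3, by positivity, ?_⟩
      rintro _ (⟨z, hz, rfl⟩ | ⟨z, hz, rfl⟩) ⟨h1, h2⟩
      · have := (preCantorSet_subset_unitInterval hz).2
        simp only at h1 h2
        linarith [hd.1]
      · simp only at h1 h2
        exact H z hz ⟨by linarith, by linarith⟩

theorem left_notMem_cantorRightEndpoints {n : ℕ} {a b : ℝ} (h : (a, b) ∈ cantorIntervals n) :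
    a ∉ cantorRightEndpoints := by
  intro ha
  obtain ⟨ε, hε, H⟩ := exists_Ioo_disjoint_cantorSet ha
  obtain ⟨m, hm, hlt⟩ := exists_pow_third_lt n hε
  obtain ⟨c, hc⟩ := exists_cantorIntervals_left hm h
  have := cantorIntervals_length hc
  exact H c (cantorRightEndpoints_subset_cantorSet ⟨m, a, hc⟩)
    ⟨cantorIntervals_lt hc, by linarith⟩

/-- The left endpoints of the ever shorter intervals that end in `b` converge to `b`. -/
theorem cantorRightEndpoints_subset_closure_diff :
    cantorRightEndpoints ⊆ closure (cantorSet \ cantorRightEndpoints) := by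
  rintro b ⟨n, a, h⟩
  refine Metric.mem_closure_iff.2 fun ε hε => ?_
  obtain ⟨m, hm, hlt⟩ := exists_pow_third_lt n hε
  obtain ⟨c, hc⟩ := exists_cantorIntervals_right hm h
  refine ⟨c, ⟨left_mem_cantorSet hc, left_notMem_cantorRightEndpoints hc⟩, ?_⟩
  rw [Real.dist_eq, cantorIntervals_length hc, abs_of_pos (by positivity)]
  exact hlt

/-- The Cantor set contains no half-open interval: it would contain one of the gaps. -/
theorem not_Ico_subset_cantorSet (x : ℝ) {ε : ℝ} (hε : 0 < ε) :
    ¬ Ico x (x + ε) ⊆ cantorSet := by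
  intro h
  obtain ⟨b, hb, hxb, hbx⟩ := exists_rightEndpoint_mem_Ico (h ⟨le_rfl, by linarith⟩) hε
  obtain ⟨δ, hδ, H⟩ := exists_Ioo_disjoint_cantorSet hb
  obtain ⟨y, hby, hy⟩ := exists_between (lt_min hbx (lt_add_of_pos_right b hδ))
  exact H y (h ⟨hxb.trans hby.le, hy.trans_le (min_le_left _ _)⟩)
    ⟨hby, hy.trans_le (min_le_right _ _)⟩

theorem dense_compl_cantorSet : Dense cantorSetᶜ := by
  rw [← interior_eq_empty_iff_dense_compl, eq_empty_iff_forall_notMem]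
  intro x hx
  obtain ⟨ε, hε, h⟩ := Metric.mem_nhds_iff.1 (mem_interior_iff_mem_nhds.1 hx)
  rw [Real.ball_eq_Ioo] at h
  exact not_Ico_subset_cantorSet x hε fun y hy => h ⟨by linarith [hy.1], hy.2⟩

theorem countable_cantorRightEndpoints : cantorRightEndpoints.Countable := by
  have hfin : ∀ n, (cantorIntervals n).Finite := by
    intro n
    induction n with
    | zero => exact finite_singleton _
    | succ n ih => exact ih.biUnion fun _ _ => (finite_singleton _).insert _
  refine (countable_iUnion fun n => ((hfin n).image Prod.snd).countable).mono ?_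
  rintro b ⟨n, a, h⟩
  exact mem_iUnion.2 ⟨n, _, h, rfl⟩

theorem infinite_cantorRightEndpoints : cantorRightEndpoints.Infinite := by
  refine infinite_of_injective_forall_mem (f := fun n : ℕ => (1 / 3 : ℝ) ^ n)
    (pow_right_injective₀ (by norm_num) (by norm_num)) fun n => ?_
  obtain ⟨c, hc⟩ := exists_cantorIntervals_left (Nat.zero_le n)
    (show ((0 : ℝ), (1 : ℝ)) ∈ cantorIntervals 0 from rfl)
  rw [← cantorIntervals_length hc, sub_zero]
  exact ⟨n, 0, hc⟩

theorem nonempty_homeomorph_nat_arrow_nat_cantorSet_diff :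
    Nonempty ((ℕ → ℕ) ≃ₜ ↥(cantorSet \ cantorRightEndpoints)) := by
  refine nonempty_homeomorph_nat_arrow_nat_of_isGδ
    (isClosed_cantorSet.isGδ.inter countable_cantorRightEndpoints.isGδ_compl)
    ⟨0, zero_mem_cantorSet, left_notMem_cantorRightEndpoints (n := 0) (b := 1) rfl⟩
    (dense_compl_cantorSet.mono (compl_subset_compl.2 sdiff_subset)) fun x hx => ?_
  refine Metric.mem_closure_iff.2 fun ε hε => ?_
  obtain ⟨b, hb, hxb, hbx⟩ := exists_rightEndpoint_mem_Ico hx.1 hε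
  refine ⟨b, ⟨cantorRightEndpoints_subset_closure_diff hb, fun h => h.2 hb⟩, ?_⟩
  rw [dist_comm, Real.dist_eq, abs_of_nonneg (by linarith)]
  linarith

/-! ### The Hattori space -/

theorem HattoriSpace.continuous_of_symm (A : Set ℝ) :
    Continuous (HattoriSpace.of A).symm := by
  refine continuous_def.2 fun U hU x hx => ?_
  obtain ⟨ε, hε, h⟩ := Metric.isOpen_iff.1 hU x hx
  rw [Real.ball_eq_Ioo] at h
  refine ⟨fun _ => ⟨ε, hε, ?_⟩, fun _ => ⟨ε, hε, ?_⟩⟩ <;> rintro _ ⟨y, hy, rfl⟩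
  · exact h hy
  · exact h ⟨(sub_lt_self x hε).trans_le hy.1, hy.2⟩

theorem HattoriSpace.continuousAt_of {A : Set ℝ} {x : ℝ} (hx : x ∈ A) :
    ContinuousAt (HattoriSpace.of A) x := by
  refine (HattoriSpace.nhds_basis_of_mem hx).tendsto_right_iff.2 fun ε hε => ?_
  filter_upwards [Ioo_mem_nhds (sub_lt_self x hε) (lt_add_of_pos_right x hε)] with y hy
  exact mem_image_of_mem _ hy

/-- On a subset of `A`, the topology of `H(A)` is that of the real line. -/
def HattoriSpace.homeomorphImage {A S : Set ℝ} (hS : S ⊆ A) :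
    ↥(HattoriSpace.of A '' S) ≃ₜ S where
  toEquiv := ((HattoriSpace.of A).image S).symm
  continuous_toFun := by
    exact Continuous.subtype_mk (f := fun x : ↥(HattoriSpace.of A '' S) =>
      (HattoriSpace.of A).symm x)
      ((HattoriSpace.continuous_of_symm A).comp continuous_subtype_val) _
  continuous_invFun := by
    refine Continuous.subtype_mk (f := fun x : S => HattoriSpace.of A x) ?_
      fun x => mem_image_of_mem _ x.2
    exact continuous_iff_continuousAt.2 fun x =>
      (HattoriSpace.continuousAt_of (hS x.2)).comp continuousAt_subtype_val

theorem closure_hattoriB₂ :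
    closure hattoriB₂ = HattoriSpace.of cantorRightEndpointsᶜ '' cantorSet := by
  refine Subset.antisymm (closure_minimal (image_mono cantorRightEndpoints_subset_cantorSet) ?_) ?_
  · rw [Equiv.image_eq_preimage_symm]
    exact isClosed_cantorSet.preimage (HattoriSpace.continuous_of_symm _)
  · rintro _ ⟨x, hx, rfl⟩
    by_cases hxB : x ∈ cantorRightEndpoints
    · exact subset_closure (mem_image_of_mem _ hxB)
    · refine (mem_closure_iff_nhds_basis (HattoriSpace.nhds_basis_of_mem hxB)).2 fun ε hε => ?_
      obtain ⟨b, hb, hxb, hbx⟩ := exists_rightEndpoint_mem_Ico hx hε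
      exact ⟨_, mem_image_of_mem _ hb, mem_image_of_mem _ ⟨by linarith, hbx⟩⟩

theorem closure_hattoriB₂_diff :
    closure hattoriB₂ \ hattoriB₂ =
      HattoriSpace.of cantorRightEndpointsᶜ '' (cantorSet \ cantorRightEndpoints) := by
  rw [closure_hattoriB₂, hattoriB₂, image_sdiff (HattoriSpace.of _).injective]

/-- The gap of the Cantor set after a right endpoint `b` makes `b` isolated in `closure B₂`. -/
theorem exists_isOpen_inter_closure_hattoriB₂ {x : HattoriA₂} (hx : x ∈ hattoriB₂) :
    ∃ U : Set HattoriA₂, IsOpen U ∧ U ∩ closure hattoriB₂ = {x} := by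
  obtain ⟨b, hb, rfl⟩ := hx
  obtain ⟨ε, hε, H⟩ := exists_Ioo_disjoint_cantorSet hb
  refine ⟨_, HattoriSpace.isOpen_image_Ico (not_not.2 hb) (b + ε), ?_⟩
  rw [closure_hattoriB₂, ← image_inter (HattoriSpace.of _).injective, ← image_singleton]
  congr 1
  refine Subset.antisymm (fun y hy => ?_) ?_
  · exact (hy.1.1.lt_or_eq.resolve_left fun h => H y hy.2 ⟨h, hy.1.2⟩).symm
  · rintro _ rfl
    exact ⟨⟨le_rfl, by linarith⟩, cantorRightEndpoints_subset_cantorSet hb⟩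

theorem isClosed_closure_hattoriB₂_diff : IsClosed (closure hattoriB₂ \ hattoriB₂) := by
  refine isClosed_of_closure_subset fun x hx => ?_
  refine ⟨closure_minimal sdiff_subset isClosed_closure hx, fun hxB => ?_⟩
  obtain ⟨U, hU, hUx⟩ := exists_isOpen_inter_closure_hattoriB₂ hxB
  have hxU : x ∈ U := (hUx.ge rfl).1
  obtain ⟨y, hyU, hy, hyB⟩ := mem_closure_iff.1 hx U hU hxU
  obtain rfl : y = x := hUx.le ⟨hyU, hy⟩
  exact hyB hxB

theorem isNowhereDense_hattoriB₂ : IsNowhereDense hattoriB₂ := by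
  rw [IsNowhereDense, closure_hattoriB₂, eq_empty_iff_forall_notMem]
  intro x hx
  obtain ⟨x, rfl⟩ := (HattoriSpace.of cantorRightEndpointsᶜ).surjective x
  have hnhds := mem_interior_iff_mem_nhds.1 hx
  have key : ∀ ε > 0, ¬ HattoriSpace.of cantorRightEndpointsᶜ '' Ico x (x + ε) ⊆
      HattoriSpace.of cantorRightEndpointsᶜ '' cantorSet := fun ε hε h =>
    not_Ico_subset_cantorSet x hε ((image_subset_image_iff (HattoriSpace.of _).injective).1 h)
  by_cases hxB : x ∈ cantorRightEndpoints
  · obtain ⟨ε, hε, h⟩ :=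
      (HattoriSpace.nhds_basis_of_notMem (not_not.2 hxB)).mem_iff.1 hnhds
    exact key ε hε h
  · obtain ⟨ε, hε, h⟩ := (HattoriSpace.nhds_basis_of_mem hxB).mem_iff.1 hnhds
    have hsub : Ico x (x + ε) ⊆ Ioo (x - ε) (x + ε) :=
      fun y hy => ⟨(sub_lt_self x hε).trans_le hy.1, hy.2⟩
    exact key ε hε ((image_mono hsub).trans h)

theorem nonempty_homeomorph_hattoriB₂_nat : Nonempty (hattoriB₂ ≃ₜ ℕ) := by
  have hinj := (HattoriSpace.of cantorRightEndpointsᶜ).injective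
  have : Countable hattoriB₂ := (countable_cantorRightEndpoints.image _).to_subtype
  have : Infinite hattoriB₂ :=
    (infinite_cantorRightEndpoints.image hinj.injOn).to_subtype
  have : DiscreteTopology hattoriB₂ := by
    refine discreteTopology_subtype_iff'.2 fun x hx => ?_
    obtain ⟨U, hU, hUx⟩ := exists_isOpen_inter_closure_hattoriB₂ hx
    refine ⟨U, hU, Subset.antisymm ((inter_subset_inter_right U subset_closure).trans hUx.le) ?_⟩
    rintro _ rfl
    exact ⟨(hUx.ge rfl).1, hx⟩
  obtain ⟨e⟩ := nonempty_equiv_of_countable (α := hattoriB₂) (β := ℕ)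
  exact ⟨e.toHomeomorphOfDiscrete⟩

theorem nonempty_homeomorph_closure_hattoriB₂_diff_irrational :
    Nonempty (↥(closure hattoriB₂ \ hattoriB₂) ≃ₜ {x : ℝ // Irrational x}) := by
  obtain ⟨e⟩ := nonempty_homeomorph_nat_arrow_nat_cantorSet_diff
  obtain ⟨f⟩ := nonempty_homeomorph_nat_arrow_nat_irrational
  rw [closure_hattoriB₂_diff]
  exact ⟨((HattoriSpace.homeomorphImage fun _ hx => hx.2).trans e.symm).trans f⟩

theorem not_isSigmaCompact_closure_hattoriB₂_diff :
    ¬ IsSigmaCompact (closure hattoriB₂ \ hattoriB₂) := by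
  intro h
  obtain ⟨e⟩ := nonempty_homeomorph_closure_hattoriB₂_diff_irrational
  have := isSigmaCompact_iff_sigmaCompactSpace.1 h
  exact not_sigmaCompactSpace_irrational e.symm.isClosedEmbedding.sigmaCompactSpace

theorem proposition2p7 :
    (IsNowhereDense hattoriB₂ ∧ Nonempty (hattoriB₂ ≃ₜ ℕ)) ∧
    (closure hattoriB₂ = HattoriSpace.of cantorRightEndpointsᶜ '' cantorSet ∧
      ¬ IsSigmaCompact (closure hattoriB₂) ∧
      Nonempty (↥(closure hattoriB₂ \ hattoriB₂) ≃ₜ {x : ℝ // Irrational x})) ∧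
    ¬ SigmaCompactSpace HattoriA₂ := by
  refine ⟨⟨isNowhereDense_hattoriB₂, nonempty_homeomorph_hattoriB₂_nat⟩, ⟨closure_hattoriB₂,
    fun h => ?_, nonempty_homeomorph_closure_hattoriB₂_diff_irrational⟩, fun h => ?_⟩
  · exact not_isSigmaCompact_closure_hattoriB₂_diff
      (h.of_isClosed_subset isClosed_closure_hattoriB₂_diff sdiff_subset)
  · exact not_isSigmaCompact_closure_hattoriB₂_diff
      ((isSigmaCompact_univ_iff.2 h).of_isClosed_subset isClosed_closure_hattoriB₂_diff
        (subset_univ _))
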